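/- A partition is a non-increasing finite sequence $\lambda=(\lambda_0\ge\dots\ge\lambda_{h-1})$ of positive integers; its Young diagram is the set of nodes $(a,b)\in\mathbb{N}^2$ with $0\le a\le h-1$ and $0\le b\le\lambda_a-1$. Let $d,\eta,p$ be positive integers, put $r:=dp$ and $e:=\eta p$, and assume $e\ge 2$. Let $\kappa=(\kappa_k)_{k\in\mathbb{Z}/r\mathbb{Z}}$ be a family of elements of $\mathbb{Z}/e\mathbb{Z}$ that is compatible with $(d,\eta,p)$, i.e. $\kappa_{k+d}=\kappa_k+\eta$ for all $k\in\mathbb{Z}/r\mathbb{Z}$. An $r$-partition is an $r$-tuple $\boldsymbol\lambda=(\lambda^{(0)},\dots,\lambda^{(r-1)})$ of partitions. Let $Q^+:=\bigoplus_{i\in\mathbb{Z}/e\mathbb{Z}}\mathbb{N}\alpha_i$, and for an $r$-partition $\boldsymbol\lambda$ let $$\alpha_\kappa(\boldsymbol\lambda):=\sum_{c=0}^{r-1}\ \sum_{(a,b)\in\mathcal{Y}(\lambda^{(c)})}\alpha_{b-a+\kappa_c}\in Q^+,$$ where $\mathcal{Y}(\lambda^{(c)})$ is the Young diagram of $\lambda^{(c)}$.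 For $\alpha\in Q^+$ let $\mathcal{P}_\alpha^\kappa$ be the set of all $r$-partitions $\boldsymbol\lambda$ with $\alpha_\kappa(\boldsymbol\lambda)=\alpha$. Let $\sigma$ act on $Q^+$ as the additive map with $\sigma\cdot\alpha_i=\alpha_{i+\eta}$, and on $r$-partitions by ${}^{\sigma}\boldsymbol\lambda:=(\lambda^{(r-d)},\dots,\lambda^{(r-1)},\lambda^{(0)},\dots,\lambda^{(r-d-1)})$; write $[\alpha]$ and $[\boldsymbol\lambda]$ for the orbits under (the group generated by) $\sigma$. Let $\alpha\in Q^+$ be such that $\mathcal{P}_\alpha^\kappa\neq\emptyset$. Then $\#[\alpha]$ is the smallest element of the set $\{\#[\boldsymbol\lambda]:\boldsymbol\lambda\in\mathcal{P}_\alpha^\kappa\}$. In other words, for every integer $j\ge 0$ with $\sigma^j\cdot\alpha=\alpha$ there exists an $r$-partition $\boldsymbol\mu$ such that $\alpha_\kappa(\boldsymbol\mu)=\alpha$ and ${}^{\sigma^j}\boldsymbol\mu=\boldsymbol\mu$. -/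

import Mathlib

namespace Shift

/-- A partition: a non-increasing finite sequence of positive integers. -/
def IntPartition : Type := {w : List ℕ // w.SortedGE ∧ ∀ x ∈ w, 0 < x}

/-- The Young diagram of a partition: the nodes `(a, b)` (row `a`, column `b`, both counted
from `0`) with `a < h` and `b < w_a`, where `h` is the number of parts. -/
def IntPartition.diagram (w : IntPartition) : YoungDiagram :=
  YoungDiagram.ofRowLens w.1 w.2.1

theorem IntPartition.mem_diagram (w : IntPartition) (a b : ℕ) :
    (a, b) ∈ w.diagram ↔ ∃ h : a < w.1.length, b < w.1[a] :=
  YoungDiagram.mem_ofRowLens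

/-- An `r`-partition: an `r`-tuple of partitions, the components being indexed by
`ℤ/rℤ`, identified with `{0, …, r - 1}`. -/
abbrev Multipartition (r : ℕ) : Type := ZMod r → IntPartition

/-- `Q⁺ = ⨁_{i ∈ ℤ/eℤ} ℕ α_i`, with `α_i = Pi.single i 1`. -/
abbrev QPlus (e : ℕ) : Type := ZMod e → ℕ

/-- The `κ`-residue `b - a + κ_c` of the node `(a, b, c)`. -/
def residue {e r : ℕ} (κ : ZMod r → ZMod e) (a b : ℕ) (c : ZMod r) : ZMod e :=
  (b : ZMod e) - (a : ZMod e) + κ c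

/-- `α_κ(l) = ∑ α_{res_κ(γ)}`, the sum being over all the nodes `γ = (a, b, c)` of the Young
diagram of the `r`-partition `l`. -/
def content {e r : ℕ} [NeZero r] (κ : ZMod r → ZMod e) (l : Multipartition r) : QPlus e :=
  ∑ c : ZMod r, ∑ γ ∈ (l c).diagram.cells, Pi.single (residue κ γ.1 γ.2 c) 1

/-- The set `P_α^κ` of all `r`-partitions `l` such that `α_κ(l) = α`. -/
def block {e r : ℕ} [NeZero r] (κ : ZMod r → ZMod e) (α : QPlus e) : Set (Multipartition r) :=
  {l | content κ l = α}

/-- For `r = d p` and `e = η p`, the multicharge `κ` is compatible with `(d, η, p)` when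
`κ_{k + d} = κ_k + η` for all `k ∈ ℤ/rℤ`. -/
def Compatible {e r : ℕ} (d η : ℕ) (κ : ZMod r → ZMod e) : Prop :=
  ∀ k : ZMod r, κ (k + (d : ZMod r)) = κ k + (η : ZMod e)

/-- The cyclic shift of families indexed by `ℤ/mℤ`: the `k`-th entry of the image of `f` is the
entry of `f` of index `k - s`. -/
def cyclicShift {X : Type} (m s : ℕ) : Equiv.Perm (ZMod m → X) where
  toFun f k := f (k - (s : ZMod m))
  invFun f k := f (k + (s : ZMod m))
  left_inv f := by funext k; simp
  right_inv f := by funext k; simp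

/-- The shift of `r`-partitions,
`σ(l^(0), …, l^(r-1)) = (l^(r-d), …, l^(r-1), l^(0), …, l^(r-d-1))`. -/
def shiftMultipartition (r d : ℕ) : Equiv.Perm (Multipartition r) := cyclicShift r d

/-- The shift of `Q⁺`, that is, the additive map with `σ · α_i = α_{i + η}`. -/
def shiftQPlus (e η : ℕ) : Equiv.Perm (QPlus e) := cyclicShift e η

theorem shiftQPlus_add (e η : ℕ) (α β : QPlus e) :
    shiftQPlus e η (α + β) = shiftQPlus e η α + shiftQPlus e η β := rfl

theorem shiftQPlus_single (e η : ℕ) (i : ZMod e) :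
    shiftQPlus e η (Pi.single i 1) = Pi.single (i + (η : ZMod e)) 1 := by
  funext k
  simp [shiftQPlus, cyclicShift, Pi.single_apply, sub_eq_iff_eq_add]

/-- The orbit of `x` under the group generated by the permutation `σ`. -/
def orbit {X : Type} (σ : Equiv.Perm X) (x : X) : Set X :=
  MulAction.orbit (Subgroup.zpowers σ) x

end Shift

namespace Shift

/-! Replacing `d, η, p` by `d * g, η * g, p / g` with `g = gcd(j, p)` reduces the existence
statement to an `α` fixed by `σ` itself. Such an `α` descends to a function `a` on ℤ/η, and the
charges `κ (c + d * k)`, `k < p`, agree modulo `η`. So a shift-invariant `r`-partition of content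
`α` amounts to `d` diagrams whose contents modulo `η` add up to `a`, while the given `r`-partition
consists of `p` families of `d` diagrams whose contents add up to `p * a`. An average must be
replaced by an actual family.

By the abacus, the contents modulo `η` of diagrams with charge `s` are exactly the integral `β` with
∑ (β_i - β_{i+1})² ≤ 2 β_s (`sum_sq_le_diagramContent`, `exists_diagramContent_eq`). In terms of the
differences of `β` this is a separable convex inequality. The averaged matrix of differences has
integral row and column sums, so it can be rounded to an integral one without increasing the linear
interpolation of the convex function between consecutive integers (`exists_integral_rounding`,
`exists_family_of_average`).

For orbit sizes, content is equivariant, so #[α] divides every #[λ]; a fixed point for `j = #[α]`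
attains the bound. -/

/-! ### Integral rounding of transportation matrices -/

theorem card_two_of_not_integral {ι : Type*} [DecidableEq ι] (s : Finset ι) (f : ι → ℚ) (m : ℤ)
    (hm : ∑ i ∈ s, f i = m) (i₀ : ι) (h₀ : i₀ ∈ s) (hf : ∀ n : ℤ, f i₀ ≠ n)
    (t : Finset ι) (ht : ∀ i, i ∈ t ↔ i ∈ s ∧ ∀ n : ℤ, f i ≠ n) : 2 ≤ t.card := by
  by_contra hlt
  have h1 : t.card ≤ 1 := by omega
  have hint : ∀ i ∈ s.erase i₀, ∃ n : ℤ, f i = n := by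
    intro i hi
    by_contra hn
    push Not at hn
    exact (Finset.mem_erase.1 hi).1 (Finset.card_le_one.1 h1 i
      ((ht i).2 ⟨(Finset.mem_erase.1 hi).2, hn⟩) i₀ ((ht i₀).2 ⟨h₀, hf⟩))
  choose! g hg using hint
  refine hf (m - ∑ i ∈ s.erase i₀, g i) ?_
  rw [← Finset.add_sum_erase s f h₀, Finset.sum_congr rfl hg] at hm
  push_cast
  linarith

/-- If every row and every column met by `F` contains at least two entries of `F`, then some
nonzero matrix supported on `F` has all its row and column sums equal to `0`. -/
theorem exists_circulation {C I : Type*} [Fintype C] [Fintype I] [DecidableEq C] [DecidableEq I]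
    (F : Finset (C × I)) (hF : F.Nonempty)
    (h1 : ∀ c ∈ F.image Prod.fst, 2 ≤ (F.filter (fun q => q.1 = c)).card)
    (h2 : ∀ i ∈ F.image Prod.snd, 2 ≤ (F.filter (fun q => q.2 = i)).card) :
    ∃ v : C → I → ℚ, (∃ c i, v c i ≠ 0) ∧ (∀ c i, (c, i) ∉ F → v c i = 0) ∧
      (∀ c, ∑ i, v c i = 0) ∧ ∀ i, ∑ c, v c i = 0 := by
  obtain ⟨q₀, hq₀⟩ := hF
  let R := F.image Prod.fst
  -- One column condition is redundant, since rows and columns have the same total. Dropping it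
  -- makes the number of conditions strictly smaller than `F.card`.
  let S := (F.image Prod.snd).erase q₀.2
  let ext : (F → ℚ) → C → I → ℚ := fun w c i => if h : (c, i) ∈ F then w ⟨(c, i), h⟩ else 0
  have ext_add : ∀ w w' c i, ext (w + w') c i = ext w c i + ext w' c i := by
    intro w w' c i; by_cases h : (c, i) ∈ F <;> simp [ext, h]
  have ext_smul : ∀ (a : ℚ) w c i, ext (a • w) c i = a * ext w c i := by
    intro a w c i; by_cases h : (c, i) ∈ F <;> simp [ext, h]
  let Φ : (F → ℚ) →ₗ[ℚ] ((R → ℚ) × (S → ℚ)) :=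
    { toFun := fun w => (fun c => ∑ i, ext w c i, fun i => ∑ c, ext w c i)
      map_add' := by
        intro w w'
        ext <;> simp [ext_add, Finset.sum_add_distrib]
      map_smul' := by
        intro a w
        ext <;> simp [ext_smul, Finset.mul_sum] }
  have hR : 2 * R.card ≤ F.card := by
    have := Finset.mul_card_image_le_card F 2 (f := Prod.fst) h1
    exact this
  have hS' : 2 * (F.image Prod.snd).card ≤ F.card := Finset.mul_card_image_le_card F 2 h2
  have hmem : q₀.2 ∈ F.image Prod.snd := Finset.mem_image_of_mem _ hq₀
  have hS : S.card + 1 = (F.image Prod.snd).card := Finset.card_erase_add_one hmem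
  have hdim : Module.finrank ℚ ((R → ℚ) × (S → ℚ)) < Module.finrank ℚ (F → ℚ) := by
    rw [Module.finrank_prod, Module.finrank_fintype_fun_eq_card,
      Module.finrank_fintype_fun_eq_card, Module.finrank_fintype_fun_eq_card]
    simp only [Fintype.card_coe]
    omega
  obtain ⟨w, hw, hw0⟩ := (Submodule.ne_bot_iff _).1 (LinearMap.ker_ne_bot_of_finrank_lt hdim (f := Φ))
  have hΦ : Φ w = 0 := hw
  have hsupp : ∀ c i, (c, i) ∉ F → ext w c i = 0 := fun c i h => by simp [ext, h]
  have hrow : ∀ c, ∑ i, ext w c i = 0 := by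
    intro c
    by_cases hc : c ∈ R
    · exact congrFun (congrArg Prod.fst hΦ) ⟨c, hc⟩
    · exact Finset.sum_eq_zero fun i _ => hsupp c i fun h => hc (Finset.mem_image_of_mem Prod.fst h)
  have hcol : ∀ i, i ≠ q₀.2 → ∑ c, ext w c i = 0 := by
    intro i hi
    by_cases hc : i ∈ F.image Prod.snd
    · exact congrFun (congrArg Prod.snd hΦ) ⟨i, Finset.mem_erase.2 ⟨hi, hc⟩⟩
    · exact Finset.sum_eq_zero fun c _ => hsupp c i fun h => hc (Finset.mem_image_of_mem Prod.snd h)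
  refine ⟨ext w, ?_, hsupp, hrow, ?_⟩
  · obtain ⟨q, hq⟩ := Function.ne_iff.1 hw0
    exact ⟨q.1.1, q.1.2, by simpa [ext] using hq⟩
  · intro i
    by_cases hi : i = q₀.2
    · have h : ∑ i, ∑ c, ext w c i = 0 := by
        rw [Finset.sum_comm]; exact Finset.sum_eq_zero fun c _ => hrow c
      rw [Finset.sum_eq_single q₀.2 (fun i _ hi => hcol i hi) (by simp)] at h
      rw [hi, h]
    · exact hcol i hi

/-- From a nonintegral point `a` one can move in the direction `v` up to an integer without leaving
the interval `[⌊a⌋, ⌈a⌉]`. -/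
theorem exists_step_to_integer (a v : ℚ) (ha : ∀ n : ℤ, a ≠ n) (hv : v ≠ 0) :
    ∃ T : ℚ, 0 < T ∧ (∃ n : ℤ, a + T * v = n) ∧
      ∀ t, 0 ≤ t → t ≤ T → (⌊a⌋ : ℚ) ≤ a + t * v ∧ a + t * v ≤ ⌈a⌉ := by
  have hfl : (⌊a⌋ : ℚ) < a := lt_of_le_of_ne (Int.floor_le a) (ha _).symm
  have hce : a < ⌈a⌉ := lt_of_le_of_ne (Int.le_ceil a) (ha _)
  rcases lt_or_gt_of_ne hv with hv | hv
  · refine ⟨(a - ⌊a⌋) / (-v), div_pos (by linarith) (by linarith), ⟨⌊a⌋, ?_⟩, ?_⟩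
    · field_simp; ring
    · intro t h0 ht
      rw [le_div_iff₀ (by linarith)] at ht
      exact ⟨by linarith, by nlinarith⟩
  · refine ⟨(⌈a⌉ - a) / v, div_pos (by linarith) hv, ⟨⌈a⌉, ?_⟩, ?_⟩
    · field_simp; ring
    · intro t h0 ht
      rw [le_div_iff₀ hv] at ht
      exact ⟨by nlinarith, by linarith⟩

/-- Integrality of transportation problems: a rational matrix with integral row and column sums can
be rounded entrywise, keeping these sums and not increasing a given linear cost. -/
theorem exists_integral_rounding {C I : Type*} [Fintype C] [Fintype I] (l : C → I → ℚ)
    (row : C → ℤ) (col : I → ℤ) (A : C → I → ℚ)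
    (hrow : ∀ c, ∑ i, A c i = row c) (hcol : ∀ i, ∑ c, A c i = col i) :
    ∃ M : C → I → ℤ, (∀ c i, ⌊A c i⌋ ≤ M c i ∧ M c i ≤ ⌈A c i⌉) ∧
      (∀ c, ∑ i, M c i = row c) ∧ (∀ i, ∑ c, M c i = col i) ∧
      ∑ c, ∑ i, l c i * M c i ≤ ∑ c, ∑ i, l c i * A c i := by
  classical
  induction hn : (Finset.univ.filter fun q : C × I => ∀ n : ℤ, A q.1 q.2 ≠ n).card
    using Nat.strong_induction_on generalizing A with
  | _ n ih =>
  set F := Finset.univ.filter fun q : C × I => ∀ n : ℤ, A q.1 q.2 ≠ n with hFdef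
  have hmemF : ∀ c i, (c, i) ∈ F ↔ ∀ n : ℤ, A c i ≠ n := by intro c i; simp [hFdef]
  rcases F.eq_empty_or_nonempty with hF | hF
  · have hint : ∀ c i, ∃ n : ℤ, A c i = n := by
      intro c i
      by_contra h
      push Not at h
      have := (hmemF c i).2 h
      simp [hF] at this
    choose M hM using hint
    refine ⟨M, fun c i => by simp [hM], fun c => ?_, fun i => ?_, by simp [hM]⟩
    · have := hrow c
      simp only [hM] at this
      exact_mod_cast this
    · have := hcol i
      simp only [hM] at this
      exact_mod_cast this
  · obtain ⟨v, ⟨c₁, i₁, hne⟩, hsupp, hvr, hvc⟩ := exists_circulation F hF (by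
      intro c hc
      obtain ⟨⟨c', i⟩, hq, rfl⟩ := Finset.mem_image.1 hc
      have := card_two_of_not_integral Finset.univ (A c') (row c') (hrow c') i (Finset.mem_univ _)
        ((hmemF _ _).1 hq) _ (fun i => Finset.mem_filter)
      refine this.trans (Finset.card_le_card_of_injOn (fun i => (c', i)) ?_ ?_)
      · intro i hi
        simp only [Finset.coe_filter, Finset.mem_univ, true_and, Set.mem_ofPred_eq, and_true] at hi ⊢
        exact (hmemF _ _).2 hi
      · intro i _ j _ h
        exact (Prod.ext_iff.1 h).2) (by
      intro i hi
      obtain ⟨⟨c, i'⟩, hq, rfl⟩ := Finset.mem_image.1 hi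
      have := card_two_of_not_integral Finset.univ (fun c => A c i') (col i') (hcol i') c
        (Finset.mem_univ _) ((hmemF _ _).1 hq) _ (fun i => Finset.mem_filter)
      refine this.trans (Finset.card_le_card_of_injOn (fun c => (c, i')) ?_ ?_)
      · intro c hc
        simp only [Finset.coe_filter, Finset.mem_univ, true_and, Set.mem_ofPred_eq, and_true] at hc ⊢
        exact (hmemF _ _).2 hc
      · intro i _ j _ h
        exact (Prod.ext_iff.1 h).1)
    -- A circulation may be replaced by its negative.
    wlog hcost : ∑ c, ∑ i, l c i * v c i ≤ 0 generalizing v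
    · refine this (fun c i => - v c i) (by simpa using hne) ?_ ?_ ?_ ?_
      · intro c i h; simp [hsupp c i h]
      · intro c; simp [hvr c]
      · intro i; simp [hvc i]
      · simp only [mul_neg, Finset.sum_neg_distrib]; linarith
    have hstep : ∀ q : C × I, v q.1 q.2 ≠ 0 → ∃ T : ℚ, 0 < T ∧
        (∃ n : ℤ, A q.1 q.2 + T * v q.1 q.2 = n) ∧ ∀ t, 0 ≤ t → t ≤ T →
          (⌊A q.1 q.2⌋ : ℚ) ≤ A q.1 q.2 + t * v q.1 q.2 ∧
            A q.1 q.2 + t * v q.1 q.2 ≤ ⌈A q.1 q.2⌉ := by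
      intro q hq
      refine exists_step_to_integer _ _ ((hmemF _ _).1 ?_) hq
      by_contra h
      exact hq (hsupp _ _ h)
    choose! T hTpos hTint hTbd using hstep
    -- Move along `v` until the first entry becomes integral: the number of nonintegral entries
    -- drops and no entry leaves its unit interval.
    obtain ⟨q, hq, hmin⟩ := Finset.exists_min_image
      (Finset.univ.filter fun q : C × I => v q.1 q.2 ≠ 0) T ⟨(c₁, i₁), by simpa using hne⟩
    simp only [Finset.mem_filter, Finset.mem_univ, true_and] at hq hmin
    have hbd : ∀ c i, (⌊A c i⌋ : ℚ) ≤ A c i + T q * v c i ∧ A c i + T q * v c i ≤ ⌈A c i⌉ := by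
      intro c i
      by_cases h : v c i = 0
      · simp [h, Int.floor_le, Int.le_ceil]
      · exact hTbd (c, i) h _ (hTpos q hq).le (hmin (c, i) h)
    obtain ⟨M, hM, hMr, hMc, hMl⟩ := ih _ (by
        rw [← hn]
        refine Finset.card_lt_card (Finset.ssubset_iff_of_subset ?_ |>.2 ⟨q, ?_, ?_⟩)
        · intro q' hq'
          by_contra h
          have hz : v q'.1 q'.2 = 0 := hsupp _ _ h
          simp only [Finset.mem_filter, Finset.mem_univ, true_and] at hq'
          refine h ((hmemF _ _).2 fun n => ?_)
          simpa [hz] using hq' n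
        · by_contra h
          exact hq (hsupp _ _ h)
        · simpa using hTint q hq)
      (fun c i => A c i + T q * v c i)
      (fun c => by simp [Finset.sum_add_distrib, ← Finset.mul_sum, hrow, hvr])
      (fun i => by simp [Finset.sum_add_distrib, ← Finset.mul_sum, hcol, hvc]) rfl
    refine ⟨M, fun c i => ⟨?_, ?_⟩, hMr, hMc, hMl.trans ?_⟩
    · exact (Int.le_floor.2 (hbd c i).1).trans (hM c i).1
    · exact (hM c i).2.trans (Int.ceil_le.2 (hbd c i).2)
    · have : ∑ c, ∑ i, l c i * (A c i + T q * v c i)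
          = ∑ c, ∑ i, l c i * A c i + T q * ∑ c, ∑ i, l c i * v c i := by
        simp only [Finset.mul_sum, ← Finset.sum_add_distrib]
        refine Finset.sum_congr rfl fun c _ => Finset.sum_congr rfl fun i _ => by ring
      rw [this]
      have := mul_nonpos_of_nonneg_of_nonpos (hTpos q hq).le hcost
      linarith

/-! ### Beta-sets of Young diagrams -/

theorem sum_cells_eq (μ : YoungDiagram) (h : ℕ) (hh : μ.colLen 0 ≤ h) (f : ℕ → ℕ → ℤ) :
    ∑ γ ∈ μ.cells, f γ.1 γ.2 = ∑ a ∈ Finset.range h, ∑ b ∈ Finset.range (μ.rowLen a), f a b := by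
  refine Finset.sum_finset_product' _ _ _ ?_
  rintro ⟨a, b⟩
  simp only [YoungDiagram.mem_cells, Finset.mem_range, ← YoungDiagram.mem_iff_lt_rowLen]
  refine ⟨fun hm => ⟨?_, hm⟩, fun hm => hm.2⟩
  have : (a, 0) ∈ μ := μ.up_left_mem le_rfl (Nat.zero_le b) hm
  exact (YoungDiagram.mem_iff_lt_colLen.1 this).trans_le hh

/-- Each row telescopes to its two ends. Keeping `G` arbitrary lets one identity serve both for
indicators of residue classes and for the quotient by `η`. -/
theorem sum_cells_sub (μ : YoungDiagram) (h : ℕ) (hh : μ.colLen 0 ≤ h) (G : ℤ → ℤ) :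
    ∑ γ ∈ μ.cells, (G ((γ.2 : ℤ) - γ.1) - G ((γ.2 : ℤ) - γ.1 - 1)) =
      ∑ a ∈ Finset.range h, (G ((μ.rowLen a : ℤ) - a - 1) - G (-(a : ℤ) - 1)) := by
  rw [sum_cells_eq μ h hh fun a b => G ((b : ℤ) - a) - G ((b : ℤ) - a - 1)]
  refine Finset.sum_congr rfl fun a _ => ?_
  have := Finset.sum_range_sub (fun b : ℕ => G ((b : ℤ) - a - 1)) (μ.rowLen a)
  simp only [Nat.cast_zero, zero_sub] at this
  rw [← this]
  refine Finset.sum_congr rfl fun b _ => ?_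
  push_cast
  congr 2
  ring

theorem sum_range_vacuum (h : ℕ) (G : ℤ → ℤ) :
    ∑ a ∈ Finset.range h, G (-(a : ℤ) - 1) = ∑ y ∈ Finset.range h, G ((y : ℤ) - h) := by
  rw [← Finset.sum_range_reflect]
  refine Finset.sum_congr rfl fun a ha => ?_
  have := Finset.mem_range.1 ha
  congr 1
  omega

/-- The `h`-element beta-set of a diagram with at most `h` rows. -/
theorem exists_betaSet (μ : YoungDiagram) (h : ℕ) (hh : μ.colLen 0 ≤ h) :
    ∃ D : Finset ℕ, D.card = h ∧ ∀ G : ℤ → ℤ,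
      ∑ γ ∈ μ.cells, (G ((γ.2 : ℤ) - γ.1) - G ((γ.2 : ℤ) - γ.1 - 1)) =
        ∑ y ∈ D, G ((y : ℤ) - h) - ∑ y ∈ Finset.range h, G ((y : ℤ) - h) := by
  have hinj : Set.InjOn (fun a => μ.rowLen a + (h - 1 - a)) (Finset.range h : Finset ℕ) := by
    intro a ha b hb hab
    simp only [Finset.coe_range, Set.mem_Iio] at ha hb hab
    rcases lt_trichotomy a b with hlt | hlt | hlt
    · have := μ.rowLen_anti a b hlt.le
      omega
    · exact hlt
    · have := μ.rowLen_anti b a hlt.le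
      omega
  refine ⟨(Finset.range h).image fun a => μ.rowLen a + (h - 1 - a), ?_, fun G => ?_⟩
  · rw [Finset.card_image_of_injOn hinj, Finset.card_range]
  · rw [sum_cells_sub μ h hh, Finset.sum_sub_distrib, Finset.sum_image hinj, sum_range_vacuum]
    congr 1
    refine Finset.sum_congr rfl fun a ha => ?_
    have := Finset.mem_range.1 ha
    congr 1
    omega

theorem exists_diagram_rowLen (h : ℕ) (r : ℕ → ℕ) (hr : Antitone r) :
    ∃ μ : YoungDiagram, μ.colLen 0 ≤ h ∧ ∀ a < h, μ.rowLen a = r a := by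
  let μ : YoungDiagram :=
    { cells := (Finset.range h ×ˢ Finset.range (r 0)).filter fun γ => γ.2 < r γ.1
      isLowerSet := by
        rintro ⟨a, b⟩ ⟨a', b'⟩ hle hm
        have h1 : a' ≤ a := hle.1
        have h2 : b' ≤ b := hle.2
        simp only [Finset.coe_filter, Finset.mem_product, Finset.mem_range,
          Set.mem_ofPred_eq] at hm ⊢
        have := hr h1
        omega }
  have hμ : ∀ a b, (a, b) ∈ μ ↔ a < h ∧ b < r a := by
    intro a b
    rw [← YoungDiagram.mem_cells]
    simp only [μ, Finset.mem_filter, Finset.mem_product, Finset.mem_range]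
    have := hr (Nat.zero_le a)
    omega
  refine ⟨μ, ?_, fun a ha => ?_⟩
  · by_contra hlt
    have := (hμ _ _).1 (YoungDiagram.mem_iff_lt_colLen.2 (not_le.1 hlt))
    omega
  · refine eq_of_forall_lt_iff fun b => ?_
    rw [← YoungDiagram.mem_iff_lt_rowLen, hμ]
    simp [ha]

/-- Every finite set of natural numbers is a beta-set. -/
theorem exists_diagram_of_betaSet (D : Finset ℕ) (h : ℕ) (hD : D.card = h) :
    ∃ μ : YoungDiagram, ∀ G : ℤ → ℤ,
      ∑ γ ∈ μ.cells, (G ((γ.2 : ℤ) - γ.1) - G ((γ.2 : ℤ) - γ.1 - 1)) =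
        ∑ y ∈ D, G ((y : ℤ) - h) - ∑ y ∈ Finset.range h, G ((y : ℤ) - h) := by
  let f := D.orderEmbOfFin hD
  have hstep : ∀ (m n : ℕ) (hm : m < h) (hn : n < h), m ≤ n →
      f ⟨m, hm⟩ + (n - m) ≤ f ⟨n, hn⟩ := by
    intro m n hm hn hmn
    induction n, hmn using Nat.le_induction with
    | base => simp
    | succ n hmn ih =>
      have h1 := ih (by omega)
      have h2 : f ⟨n, by omega⟩ < f ⟨n + 1, hn⟩ := f.strictMono (by simp)
      omega
  have hge : ∀ (m : ℕ) (hm : m < h), m ≤ f ⟨m, hm⟩ := by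
    intro m hm
    have := hstep 0 m (by omega) hm (Nat.zero_le _)
    omega
  -- Row `a` is the `a`-th largest element of `D` minus the number of elements of `D` below it;
  -- `hge` shows that this subtraction does not truncate.
  obtain ⟨μ, hμh, hμ⟩ := exists_diagram_rowLen h
    (fun a => if ha : a < h then f ⟨h - 1 - a, by omega⟩ - (h - 1 - a) else 0) (by
      intro a b hab
      by_cases hb : b < h
      · have ha : a < h := by omega
        simp only [ha, hb, dif_pos]
        have := hstep (h - 1 - b) (h - 1 - a) (by omega) (by omega) (by omega)
        omega
      · simp [hb])
  refine ⟨μ, fun G => ?_⟩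
  rw [sum_cells_sub μ h hμh, Finset.sum_sub_distrib, sum_range_vacuum]
  congr 1
  have hsum : ∑ y ∈ D, G ((y : ℤ) - h) = ∑ m : Fin h, G ((f m : ℤ) - h) := by
    rw [← Finset.map_orderEmbOfFin_univ D hD, Finset.sum_map]
    rfl
  rw [hsum, ← Finset.sum_range_reflect, ← Fin.sum_univ_eq_sum_range
    (fun a => G ((μ.rowLen (h - 1 - a) : ℤ) - ((h - 1 - a : ℕ) : ℤ) - 1))]
  refine Finset.sum_congr rfl fun m _ => ?_
  have hm := m.2
  have e1 : h - 1 - (h - 1 - (m : ℕ)) = m := by omega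
  rw [hμ _ (by omega), dif_pos (by omega)]
  simp only [e1, Fin.eta]
  have := hge m hm
  simp only [Fin.eta] at this
  congr 1
  omega

/-! ### The abacus and contents modulo `η` -/

/-- Splitting a finite set of natural numbers according to residues modulo `η`. -/
theorem sum_eq_sum_runners (η : ℕ) [NeZero η] (D : Finset ℕ) :
    ∃ T : ZMod η → Finset ℕ, ∀ g : ℕ → ℤ, ∑ y ∈ D, g y = ∑ j, ∑ k ∈ T j, g (j.val + η * k) := by
  have hval : ∀ (y : ℕ) (j : ZMod η), (y : ZMod η) = j → j.val + η * (y / η) = y := by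
    rintro y _ rfl
    rw [ZMod.val_natCast, Nat.mod_add_div]
  refine ⟨fun j => (D.filter fun y : ℕ => (y : ZMod η) = j).image (· / η), fun g => ?_⟩
  rw [← Finset.sum_fiberwise D (fun y : ℕ => (y : ZMod η)) g]
  refine Finset.sum_congr rfl fun j _ => ?_
  rw [Finset.sum_image]
  · exact Finset.sum_congr rfl fun y hy => by rw [hval y j (Finset.mem_filter.1 hy).2]
  · intro y hy z hz hyz
    have h1 := hval y j (Finset.mem_filter.1 hy).2
    have h2 := hval z j (Finset.mem_filter.1 hz).2
    simp only at hyz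
    rw [← h1, ← h2, hyz]

theorem val_add_mul_inj {η : ℕ} [NeZero η] {j j' : ZMod η} {k k' : ℕ}
    (h : j.val + η * k = j'.val + η * k') : j = j' ∧ k = k' := by
  have h1 := congrArg (fun n : ℕ => (n : ZMod η)) h
  simp at h1
  subst h1
  exact ⟨rfl, Nat.eq_of_mul_eq_mul_left (NeZero.pos η) (by omega)⟩

theorem exists_finset_of_runners (η : ℕ) [NeZero η] (T : ZMod η → Finset ℕ) :
    ∃ D : Finset ℕ, ∀ g : ℕ → ℤ, ∑ y ∈ D, g y = ∑ j, ∑ k ∈ T j, g (j.val + η * k) := by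
  refine ⟨(Finset.univ.sigma T).image fun q => q.1.val + η * q.2, fun g => ?_⟩
  rw [Finset.sum_image, Finset.sum_sigma]
  rintro ⟨j, k⟩ _ ⟨j', k'⟩ _ h
  obtain ⟨rfl, rfl⟩ := val_add_mul_inj h
  rfl

theorem sum_range_mul_eq (η : ℕ) [NeZero η] (H : ℕ) (g : ℕ → ℤ) :
    ∑ y ∈ Finset.range (η * H), g y = ∑ j : ZMod η, ∑ k ∈ Finset.range H, g (j.val + η * k) := by
  rw [← Finset.sum_product']
  symm
  refine Finset.sum_bij (fun q _ => q.1.val + η * q.2) ?_ ?_ ?_ ?_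
  · rintro ⟨j, k⟩ hq
    simp only [Finset.mem_product, Finset.mem_univ, Finset.mem_range, true_and] at hq ⊢
    have := j.val_lt
    nlinarith
  · rintro ⟨j, k⟩ _ ⟨j', k'⟩ _ h
    obtain ⟨rfl, rfl⟩ := val_add_mul_inj h
    rfl
  · intro y hy
    refine ⟨((y : ZMod η), y / η), ?_, ?_⟩
    · simpa using Nat.div_lt_of_lt_mul (Finset.mem_range.1 hy)
    · simp only [ZMod.val_natCast, Nat.mod_add_div]
  · intros; rfl

/-- The number of nodes of each residue modulo `η` in a diagram with charge `s`. -/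
def diagramContent {η : ℕ} (s : ZMod η) (μ : YoungDiagram) (i : ZMod η) : ℤ :=
  ∑ γ ∈ μ.cells, if (γ.2 : ZMod η) - (γ.1 : ZMod η) + s = i then 1 else 0

theorem diagramContent_sub {η : ℕ} (s : ZMod η) (μ : YoungDiagram) (j : ZMod η) :
    diagramContent s μ (j + s) - diagramContent s μ (j + s + 1) =
      ∑ γ ∈ μ.cells, ((if (((γ.2 : ℤ) - γ.1 : ℤ) : ZMod η) = j then (1 : ℤ) else 0)
        - if (((γ.2 : ℤ) - γ.1 - 1 : ℤ) : ZMod η) = j then 1 else 0) := by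
  rw [diagramContent, diagramContent, ← Finset.sum_sub_distrib]
  refine Finset.sum_congr rfl fun γ _ => ?_
  push_cast
  congr 1
  · simp only [add_left_inj]
  · congr 1
    exact propext ⟨fun h => by linear_combination h, fun h => by linear_combination h⟩

theorem ediv_sub_ediv_pred (η : ℕ) [NeZero η] (m : ℤ) :
    m / η - (m - 1) / η = if (m : ZMod η) = 0 then 1 else 0 := by
  have hη : (0 : ℤ) < η := by exact_mod_cast NeZero.pos η
  simp only [ZMod.intCast_zmod_eq_zero_iff_dvd]
  split_ifs with hd
  · obtain ⟨q, rfl⟩ := hd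
    have h1 : ((η : ℤ) * q - 1) / η = q - 1 := by
      rw [Int.ediv_eq_iff_of_pos hη]
      constructor <;> nlinarith
    rw [h1, Int.mul_ediv_cancel_left _ hη.ne']
    ring
  · have h0 : m % η ≠ 0 := fun h => hd (Int.dvd_of_emod_eq_zero h)
    have h1 := Int.emod_nonneg m hη.ne'
    have h2 := Int.emod_lt_of_pos m hη
    have h3 := Int.emod_add_mul_ediv m η
    have h4 : (m - 1) / η = m / η := by
      rw [Int.ediv_eq_iff_of_pos hη]
      constructor
      · have : 1 ≤ m % η := by omega
        nlinarith
      · nlinarith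
    rw [h4]; ring

/-- The function `m ↦ m / η` increases by one exactly on arriving at a multiple of `η`, so its
increments detect the nodes of residue `s`. -/
theorem diagramContent_self {η : ℕ} [NeZero η] (s : ZMod η) (μ : YoungDiagram) :
    diagramContent s μ s =
      ∑ γ ∈ μ.cells, (((γ.2 : ℤ) - γ.1) / (η : ℤ) - ((γ.2 : ℤ) - γ.1 - 1) / (η : ℤ)) := by
  refine Finset.sum_congr rfl fun γ _ => ?_
  rw [ediv_sub_ediv_pred]
  simp

/-- `T` describes the beta-set of `μ` on the abacus with `η` runners, with `H` beads on each runner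
in the vacuum. -/
def IsAbacus {η : ℕ} [NeZero η] (μ : YoungDiagram) (H : ℕ) (T : ZMod η → Finset ℕ) : Prop :=
  ∀ G : ℤ → ℤ, ∑ γ ∈ μ.cells, (G ((γ.2 : ℤ) - γ.1) - G ((γ.2 : ℤ) - γ.1 - 1)) =
    ∑ j : ZMod η, (∑ k ∈ T j, G (j.val + η * ((k : ℤ) - H))
      - ∑ k ∈ Finset.range H, G (j.val + η * ((k : ℤ) - H)))

theorem runner_cast {η : ℕ} (H : ℕ) (j : ZMod η) (k : ℕ) :
    (((j.val + η * k : ℕ) : ℤ) - ((η * H : ℕ) : ℤ)) = j.val + η * ((k : ℤ) - H) := by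
  push_cast; ring

theorem exists_abacus {η : ℕ} [NeZero η] (μ : YoungDiagram) :
    ∃ (H : ℕ) (T : ZMod η → Finset ℕ), ∑ j, ((T j).card : ℤ) = η * H ∧ IsAbacus μ H T := by
  have hh : μ.colLen 0 ≤ η * μ.colLen 0 := Nat.le_mul_of_pos_left _ (NeZero.pos η)
  -- Taking the number of beads divisible by `η` gives every runner the same number of vacuum beads.
  obtain ⟨D, hD, hG⟩ := exists_betaSet μ (η * μ.colLen 0) hh
  obtain ⟨T, hT⟩ := sum_eq_sum_runners η D
  refine ⟨μ.colLen 0, T, ?_, fun G => ?_⟩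
  · have := hT fun _ => 1
    simp only [Finset.sum_const, nsmul_eq_mul, mul_one] at this
    rw [← this, hD]
    push_cast
    rfl
  · rw [hG, hT fun y => G ((y : ℤ) - _), sum_range_mul_eq, Finset.sum_sub_distrib]
    simp only [runner_cast]

theorem exists_diagram_of_abacus {η : ℕ} [NeZero η] (H : ℕ) (T : ZMod η → Finset ℕ)
    (hT : ∑ j : ZMod η, ((T j).card : ℤ) = η * H) : ∃ μ, IsAbacus μ H T := by
  obtain ⟨D, hD⟩ := exists_finset_of_runners η T
  have hc : D.card = η * H := by
    have := hD fun _ => 1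
    simp only [Finset.sum_const, nsmul_eq_mul, mul_one] at this
    rw [hT] at this
    exact_mod_cast this
  obtain ⟨μ, hμ⟩ := exists_diagram_of_betaSet D _ hc
  refine ⟨μ, fun G => ?_⟩
  rw [hμ, hD fun y => G ((y : ℤ) - _), sum_range_mul_eq, Finset.sum_sub_distrib]
  simp only [runner_cast]

/-- With `G` the indicator of the class `j`, only runner `j` contributes and each of its beads
counts once. -/
theorem IsAbacus.content_sub {η : ℕ} [NeZero η] {μ : YoungDiagram} {H : ℕ}
    {T : ZMod η → Finset ℕ} (h : IsAbacus μ H T) (s j : ZMod η) :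
    diagramContent s μ (j + s) - diagramContent s μ (j + s + 1) = (T j).card - H := by
  rw [diagramContent_sub, h fun m => if (m : ZMod η) = j then 1 else 0]
  rw [Finset.sum_eq_single j]
  · simp
  · intro j' _ hj'
    simp [hj']
  · simp

/-- With `G m = m / η`, each bead contributes its height on its runner. -/
theorem IsAbacus.content_self {η : ℕ} [NeZero η] {μ : YoungDiagram} {H : ℕ}
    {T : ZMod η → Finset ℕ} (h : IsAbacus μ H T) (s : ZMod η) :
    diagramContent s μ s =
      ∑ j, (∑ k ∈ T j, ((k : ℤ) - H) - ∑ k ∈ Finset.range H, ((k : ℤ) - H)) := by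
  have hη : (0 : ℤ) < η := by exact_mod_cast NeZero.pos η
  have hdiv : ∀ (j : ZMod η) (m : ℤ), ((j.val : ℤ) + η * m) / η = m := by
    intro j m
    have : (j.val : ℤ) < η := by exact_mod_cast j.val_lt
    rw [Int.ediv_eq_iff_of_pos hη]
    constructor <;> nlinarith
  rw [diagramContent_self, h fun m => m / η]
  simp only [hdiv]

/-! ### Characterization of the contents of one diagram -/

theorem two_mul_sum_range_sub (n : ℕ) (H : ℤ) :
    2 * ∑ k ∈ Finset.range n, ((k : ℤ) - H) = n * (n - 1) - 2 * H * n := by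
  induction n with
  | zero => simp
  | succ n ih => rw [Finset.sum_range_succ, mul_add, ih]; push_cast; ring

theorem sum_range_card_le_sum (S : Finset ℕ) :
    ∑ k ∈ Finset.range S.card, (k : ℤ) ≤ ∑ k ∈ S, (k : ℤ) := by
  have := Finset.sum_range_le_sum (s := S.map Nat.castEmbedding) (c := 0) (by simp)
  simpa using this

theorem sum_sub_shift {η : ℕ} [NeZero η] (s : ZMod η) (β : ZMod η → ℤ) (f : ℤ → ℤ) :
    ∑ j, f (β (j + s) - β (j + s + 1)) = ∑ i, f (β i - β (i + 1)) :=
  Fintype.sum_equiv (Equiv.addRight s) _ _ fun _ => rfl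

theorem sum_sub_succ {η : ℕ} [NeZero η] (β : ZMod η → ℤ) : ∑ i, (β i - β (i + 1)) = 0 := by
  rw [Finset.sum_sub_distrib, sub_eq_zero]
  exact (Fintype.sum_equiv (Equiv.addRight 1) _ _ fun _ => rfl).symm

/-- On a runner with `x` beads more than the vacuum, the total height is least when the beads are
flush, and is then (x² - x)/2 above the vacuum. The excesses `x` sum to zero over the runners. -/
theorem sum_sq_le_diagramContent {η : ℕ} [NeZero η] (s : ZMod η) (μ : YoungDiagram) :
    ∑ i, (diagramContent s μ i - diagramContent s μ (i + 1)) ^ 2 ≤ 2 * diagramContent s μ s := by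
  obtain ⟨H, T, hT, h⟩ := exists_abacus (η := η) μ
  rw [← sum_sub_shift s (diagramContent s μ) (fun x => x ^ 2)]
  simp only [h.content_sub s]
  rw [h.content_self s, Finset.mul_sum]
  have h0 : ∑ j : ZMod η, (((T j).card : ℤ) - H) = 0 := by
    rw [Finset.sum_sub_distrib, hT]; simp
  have : ∑ j : ZMod η, (((T j).card : ℤ) - H) ^ 2
      = ∑ j : ZMod η, ((((T j).card : ℤ) - H) ^ 2 - (((T j).card : ℤ) - H)) := by
    rw [Finset.sum_sub_distrib, h0, sub_zero]
  rw [this]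
  refine Finset.sum_le_sum fun j _ => ?_
  have h1 := two_mul_sum_range_sub H H
  have h2 := two_mul_sum_range_sub (T j).card H
  have h3 := sum_range_card_le_sum (T j)
  rw [Finset.sum_sub_distrib] at h2
  rw [Finset.sum_sub_distrib (s := T j)]
  simp only [Finset.sum_const, nsmul_eq_mul, Finset.card_range] at h2 ⊢
  nlinarith

theorem eq_of_sub_succ_eq {η : ℕ} [NeZero η] {f : ZMod η → ℤ} (h : ∀ i, f i - f (i + 1) = 0)
    (i j : ZMod η) : f i = f j := by
  have key : ∀ (n : ℕ) (i : ZMod η), f (i + n) = f i := by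
    intro n
    induction n with
    | zero => simp
    | succ n ih =>
      intro i
      have := h (i + n)
      rw [ih] at this
      push_cast
      rw [← add_assoc]
      linarith
  have := key (i - j).val j
  simpa using this

theorem exists_sum_sq_eq_two_mul {I : Type*} [Fintype I] (x : I → ℤ) (hx : ∑ i, x i = 0) :
    ∃ q, ∑ i, x i ^ 2 = 2 * q := by
  have h : (2 : ℤ) ∣ ∑ j, (x j ^ 2 - x j) := Finset.dvd_sum fun j _ => by
    rw [show x j ^ 2 - x j = x j * (x j - 1) by ring]
    exact (Int.even_mul_pred_self (x j)).two_dvd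
  rwa [Finset.sum_sub_distrib, hx, sub_zero] at h

/-- The differences of `β` prescribe the number of beads on each runner. Flush beads give half the
sum of squares at `s`, an integer by parity, and raising a single bead supplies the rest. -/
theorem exists_diagramContent_eq {η : ℕ} [NeZero η] (s : ZMod η) (β : ZMod η → ℤ)
    (hβ : ∑ i, (β i - β (i + 1)) ^ 2 ≤ 2 * β s) : ∃ μ, diagramContent s μ = β := by
  set x : ZMod η → ℤ := fun j => β (j + s) - β (j + s + 1) with hx
  have hx0 : ∑ j, x j = 0 := by
    have := sum_sub_shift s β id
    simp only [id] at this
    rw [hx, this, sum_sub_succ]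
  have hx2 : ∑ j, x j ^ 2 ≤ 2 * β s := by rw [sum_sub_shift s β (· ^ 2)]; exact hβ
  -- Large enough for every runner to hold at least one bead, so that runner `0` has a top bead to
  -- raise.
  let H : ℕ := 1 + ∑ j, (x j).natAbs
  have hH : ∀ j, 1 ≤ H + x j := by
    intro j
    have := Finset.single_le_sum (f := fun j => (x j).natAbs) (fun _ _ => Nat.zero_le _)
      (Finset.mem_univ j)
    simp only [H] at this ⊢
    omega
  obtain ⟨q, hq⟩ := exists_sum_sq_eq_two_mul x hx0
  obtain ⟨w, hw⟩ : ∃ w : ℕ, β s = q + w := ⟨(β s - q).toNat, by omega⟩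
  let n : ZMod η → ℕ := fun j => (H + x j).toNat - 1
  have hn : ∀ j, (n j : ℤ) + 1 = H + x j := by intro j; have := hH j; simp only [n]; omega
  -- All beads are flush except the top bead of runner `0`, raised by `w`; bead counts, hence
  -- differences, are unaffected.
  let T : ZMod η → Finset ℕ := fun j => insert (n j + if j = 0 then w else 0) (Finset.range (n j))
  have hnot : ∀ j, (n j + if j = 0 then w else 0) ∉ Finset.range (n j) := by intro j; simp
  have hcard : ∀ j, ((T j).card : ℤ) = H + x j := by
    intro j
    rw [Finset.card_insert_of_notMem (hnot j), Finset.card_range, ← hn]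
    push_cast; rfl
  obtain ⟨μ, hμ⟩ := exists_diagram_of_abacus H T (by simp [hcard, Finset.sum_add_distrib, hx0])
  refine ⟨μ, ?_⟩
  have hdiff : ∀ i, (diagramContent s μ i - β i) - (diagramContent s μ (i + 1) - β (i + 1)) = 0 := by
    intro i
    have := hμ.content_sub s (i - s)
    rw [hcard] at this
    simp only [hx, sub_add_cancel] at this
    linarith
  have hs : diagramContent s μ s = β s := by
    have hj : ∀ j, 2 * (∑ k ∈ T j, ((k : ℤ) - H) - ∑ k ∈ Finset.range H, ((k : ℤ) - H))
        = x j ^ 2 - x j + if j = 0 then 2 * (w : ℤ) else 0 := by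
      intro j
      have h1 := two_mul_sum_range_sub H H
      have h2 := two_mul_sum_range_sub (n j) H
      rw [Finset.sum_insert (hnot j)]
      have e : (x j) = n j + 1 - H := by linarith [hn j]
      rw [e, mul_sub, mul_add, h1, h2]
      push_cast
      split_ifs <;> ring
    have : 2 * diagramContent s μ s = 2 * β s := by
      rw [hμ.content_self s, Finset.mul_sum, Finset.sum_congr rfl fun j _ => hj j,
        Finset.sum_add_distrib, Finset.sum_sub_distrib, hx0, hq, hw]
      simp
      ring
    linarith
  funext i
  have := eq_of_sub_succ_eq hdiff i s
  linarith

/-! ### From averages to integral families -/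

theorem sum_zmod_eq_sum_range {η : ℕ} [NeZero η] (g : ZMod η → ℤ) :
    ∑ i, g i = ∑ m ∈ Finset.range η, g m := by
  have := sum_range_mul_eq η 1 fun m => g m
  simpa using this.symm

/-- Expressing `f 0 - f s` linearly in the differences turns the quadratic condition into a
separable one, bounded by `2 * f 0` whatever the charge. -/
theorem sum_lt_val_sub {η : ℕ} [NeZero η] (f : ZMod η → ℤ) (s : ZMod η) :
    ∑ i : ZMod η, (if i.val < s.val then 1 else 0) * (f i - f (i + 1)) = f 0 - f s := by
  have h1 := Finset.sum_range_sub' (fun m : ℕ => f m) s.val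
  simp only [Nat.cast_zero, ZMod.natCast_zmod_val] at h1
  rw [← h1, sum_zmod_eq_sum_range]
  have hs := s.val_lt
  rw [← Finset.sum_subset (Finset.range_subset_range.2 hs.le)]
  · refine Finset.sum_congr rfl fun m hm => ?_
    have hm := Finset.mem_range.1 hm
    rw [ZMod.val_natCast_of_lt (hm.trans hs), if_pos hm]
    push_cast
    ring
  · intro m hm hm'
    have hm := Finset.mem_range.1 hm
    have hm' : ¬ m < s.val := fun h => hm' (Finset.mem_range.2 h)
    rw [ZMod.val_natCast_of_lt hm, if_neg hm', zero_mul]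

theorem exists_primitive {η : ℕ} [NeZero η] (x : ZMod η → ℤ) (hx : ∑ i, x i = 0) (s : ZMod η)
    (v : ℤ) : ∃ f : ZMod η → ℤ, (∀ i, f i - f (i + 1) = x i) ∧ f s = v := by
  let P : ZMod η → ℤ := fun i => ∑ m ∈ Finset.range i.val, x m
  have hP : ∀ i, P (i + 1) - P i = x i := by
    intro i
    have hsucc : P i + x i = ∑ m ∈ Finset.range (i.val + 1), x m := by
      rw [Finset.sum_range_succ, ZMod.natCast_zmod_val]
    have hi : i + 1 = ((i.val + 1 : ℕ) : ZMod η) := by simp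
    rcases Nat.lt_or_ge (i.val + 1) η with hlt | hge
    · have : P (i + 1) = ∑ m ∈ Finset.range (i.val + 1), x m := by
        simp only [P]
        rw [hi, ZMod.val_natCast_of_lt hlt]
      linarith
    · have he : i.val + 1 = η := le_antisymm i.val_lt hge
      have h0 : i + 1 = 0 := by rw [hi, he, ZMod.natCast_self]
      have : P (i + 1) = 0 := by simp [P, h0]
      rw [he, ← sum_zmod_eq_sum_range, hx] at hsucc
      linarith
  refine ⟨fun i => v + P s - P i, fun i => ?_, by simp⟩
  rw [← hP i]
  ring

/-- An integral average of points of a product of level one weight sets is again a sum of points of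
these sets. -/
theorem exists_family_of_average {η : ℕ} [NeZero η] {C K : Type*} [Fintype C] [Nonempty C]
    [Fintype K] [Nonempty K] (s : C → ZMod η) (β : K → C → ZMod η → ℤ)
    (hβ : ∀ k c, ∑ i, (β k c i - β k c (i + 1)) ^ 2 ≤ 2 * β k c (s c)) (α : ZMod η → ℤ)
    (hα : ∀ i, ∑ k, ∑ c, β k c i = Fintype.card K * α i) :
    ∃ γ : C → ZMod η → ℤ, (∀ c, ∑ i, (γ c i - γ c (i + 1)) ^ 2 ≤ 2 * γ c (s c)) ∧
      ∀ i, ∑ c, γ c i = α i := by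
  classical
  have hK : (0 : ℚ) < Fintype.card K := by exact_mod_cast Fintype.card_pos
  let x : K → C → ZMod η → ℤ := fun k c i => β k c i - β k c (i + 1)
  let E : C → ZMod η → ℤ := fun c i => if i.val < (s c).val then 1 else 0
  let φ : C → ZMod η → ℤ → ℤ := fun c i m => m ^ 2 + 2 * E c i * m
  let A : C → ZMod η → ℚ := fun c i => (∑ k, (x k c i : ℚ)) / (Fintype.card K : ℚ)
  -- `b + l * m` is the chord of the convex function `φ` through `⌊A⌋` and `⌊A⌋ + 1`: it agrees with
  -- `φ` at these points and is at most `φ` at every integer.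
  let l : C → ZMod η → ℤ := fun c i => 2 * ⌊A c i⌋ + 1 + 2 * E c i
  let b : C → ZMod η → ℤ := fun c i => φ c i ⌊A c i⌋ - l c i * ⌊A c i⌋
  have hrow : ∀ c, ∑ i, A c i = ((0 : ℤ) : ℚ) := by
    intro c
    simp only [A]
    rw [← Finset.sum_div, Finset.sum_comm]
    have : ∀ k, ∑ i, (x k c i : ℚ) = 0 := by
      intro k
      exact_mod_cast sum_sub_succ (β k c)
    simp [this]
  have hcol : ∀ i, ∑ c, A c i = ((α i - α (i + 1) : ℤ) : ℚ) := by
    intro i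
    simp only [A]
    rw [← Finset.sum_div, Finset.sum_comm, div_eq_iff hK.ne']
    have : ∑ k, ∑ c, x k c i = (α i - α (i + 1)) * Fintype.card K := by
      simp only [x, Finset.sum_sub_distrib, hα]
      ring
    exact_mod_cast this
  obtain ⟨M, hM, hMr, hMc, hMl⟩ := exists_integral_rounding (fun c i => (l c i : ℚ)) _ _ A hrow hcol
  have hφM : ∀ c i, φ c i (M c i) = b c i + l c i * M c i := by
    intro c i
    have h1 := (hM c i).1
    have h2 := (hM c i).2.trans (Int.ceil_le_floor_add_one _)
    obtain h | h : M c i = ⌊A c i⌋ ∨ M c i = ⌊A c i⌋ + 1 := by omega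
    · rw [h]; simp only [b, φ, l]; ring
    · rw [h]; simp only [b, φ, l]; ring
  have hφx : ∀ k c i, b c i + l c i * x k c i ≤ φ c i (x k c i) := by
    intro k c i
    have : φ c i (x k c i) - (b c i + l c i * x k c i)
        = (x k c i - ⌊A c i⌋) * (x k c i - ⌊A c i⌋ - 1) := by simp only [b, φ, l]; ring
    have h2 : 0 ≤ (x k c i - ⌊A c i⌋) * (x k c i - ⌊A c i⌋ - 1) := by
      rcases le_or_gt (x k c i - ⌊A c i⌋) 0 with h | h
      · exact mul_nonneg_of_nonpos_of_nonpos h (by omega)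
      · exact mul_nonneg h.le (by omega)
    linarith
  have hφsum : ∀ (f : ZMod η → ℤ) c, ∑ i, φ c i (f i - f (i + 1))
      = ∑ i, (f i - f (i + 1)) ^ 2 + 2 * (f 0 - f (s c)) := by
    intro f c
    rw [← sum_lt_val_sub, Finset.mul_sum, ← Finset.sum_add_distrib]
    exact Finset.sum_congr rfl fun i _ => by simp only [φ, E]; ring
  have hxsum : ∑ k, ∑ c, ∑ i, φ c i (x k c i) ≤ 2 * (Fintype.card K * α 0) := by
    rw [← hα, Finset.mul_sum]
    refine Finset.sum_le_sum fun k _ => ?_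
    rw [Finset.mul_sum]
    refine Finset.sum_le_sum fun c _ => ?_
    have := hφsum (β k c) c
    have := hβ k c
    simp only [x]
    linarith
  have hcost : ∑ c, ∑ i, φ c i (M c i) ≤ 2 * α 0 := by
    have h1 : (Fintype.card K : ℚ) * ∑ c, ∑ i, (l c i : ℚ) * A c i = ∑ k, ∑ c, ∑ i, (l c i : ℚ) * x k c i := by
      rw [Finset.mul_sum, Finset.sum_comm (s := (Finset.univ : Finset K))]
      refine Finset.sum_congr rfl fun c _ => ?_
      rw [Finset.mul_sum, Finset.sum_comm (s := (Finset.univ : Finset K))]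
      refine Finset.sum_congr rfl fun i _ => ?_
      rw [← Finset.mul_sum]
      simp only [A]
      field_simp
    have h2 : ∑ k : K, ∑ c, ∑ i, (b c i + l c i * x k c i) ≤ 2 * (Fintype.card K * α 0) :=
      (Finset.sum_le_sum fun k _ => Finset.sum_le_sum fun c _ => Finset.sum_le_sum fun i _ =>
        hφx k c i).trans hxsum
    simp only [Finset.sum_add_distrib, Finset.sum_const, Finset.card_univ, nsmul_eq_mul] at h2
    have h3 : (Fintype.card K : ℚ) * ∑ c, ∑ i, (b c i : ℚ) + ∑ k, ∑ c, ∑ i, (l c i : ℚ) * x k c i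
        ≤ 2 * (Fintype.card K * α 0) := by exact_mod_cast h2
    rw [← h1] at h3
    have h4 : ((∑ c, ∑ i, φ c i (M c i) : ℤ) : ℚ) ≤ 2 * α 0 := by
      simp only [hφM, Finset.sum_add_distrib]
      push_cast
      refine le_of_mul_le_mul_left ?_ hK
      have := mul_le_mul_of_nonneg_left hMl hK.le
      linarith
    exact_mod_cast h4
  choose q hq using fun c => exists_sum_sq_eq_two_mul (M c) (hMr c)
  -- Each `g c` takes at `s c` the least value that the quadratic condition allows.
  choose g hg hgs using fun c => exists_primitive (M c) (hMr c) (s c) (q c)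
  let t : ℤ := α 0 - ∑ c, g c 0
  have ht : 0 ≤ t := by
    have : ∑ c, ∑ i, φ c i (M c i) = 2 * ∑ c, g c 0 := by
      rw [Finset.mul_sum]
      refine Finset.sum_congr rfl fun c _ => ?_
      have := hφsum (g c) c
      simp only [hg, hq, hgs] at this
      rw [this]
      ring
    simp only [t]
    linarith
  obtain ⟨c₀⟩ := ‹Nonempty C›
  -- The surplus `t` is constant in `i`: it leaves all differences alone and, being nonnegative,
  -- only relaxes the inequality at `c₀`.
  refine ⟨fun c i => g c i + if c = c₀ then t else 0, fun c => ?_, fun i => ?_⟩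
  · simp only [add_sub_add_right_eq_sub, hg, hq, hgs]
    split_ifs <;> linarith
  · have hconst : ∀ i, (α i - ∑ c, g c i) - (α (i + 1) - ∑ c, g c (i + 1)) = 0 := by
      intro i
      have := hMc i
      simp only [← hg, Finset.sum_sub_distrib] at this
      linarith
    have := eq_of_sub_succ_eq hconst i 0
    simp only [Finset.sum_add_distrib, Finset.sum_ite_eq', Finset.mem_univ, if_true, t]
    linarith


/-! ### Shifts, contents and orbits -/

theorem IntPartition.exists_diagram_eq (μ : YoungDiagram) : ∃ w : IntPartition, w.diagram = μ :=
  ⟨⟨μ.rowLens, μ.rowLens_sorted, μ.pos_of_mem_rowLens⟩, YoungDiagram.ofRowLens_to_rowLens_eq_self⟩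

theorem content_apply {e r : ℕ} [NeZero r] (κ : ZMod r → ZMod e) (l : Multipartition r)
    (u : ZMod e) : (content κ l u : ℤ) =
      ∑ c, ∑ γ ∈ (l c).diagram.cells, if residue κ γ.1 γ.2 c = u then 1 else 0 := by
  simp only [content, Finset.sum_apply, Pi.single_apply]
  push_cast
  simp only [eq_comm]

theorem cyclicShift_pow_apply {X : Type} (m s j : ℕ) (f : ZMod m → X) (k : ZMod m) :
    (cyclicShift m s ^ j) f k = f (k - (j : ZMod m) * (s : ZMod m)) := by
  induction j generalizing k with
  | zero => simp
  | succ j ih =>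
    rw [pow_succ', Equiv.Perm.mul_apply]
    change (cyclicShift m s ^ j) f (k - (s : ZMod m)) = _
    rw [ih]
    congr 1
    push_cast
    ring

theorem cyclicShift_pow_self {X : Type} (m s : ℕ) :
    (cyclicShift m s : Equiv.Perm (ZMod m → X)) ^ m = 1 := by
  ext f k
  rw [cyclicShift_pow_apply]
  simp

theorem content_shift {e r d η : ℕ} [NeZero r] {κ : ZMod r → ZMod e} (hκ : Compatible d η κ)
    (l : Multipartition r) :
    content κ (shiftMultipartition r d l) = shiftQPlus e η (content κ l) := by
  funext u
  have h : (content κ (shiftMultipartition r d l) u : ℤ) = content κ l (u - η) := by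
    rw [content_apply, content_apply]
    refine (Fintype.sum_equiv (Equiv.addRight (d : ZMod r)) _ _ fun c => ?_).symm
    simp only [Equiv.coe_addRight, shiftMultipartition, cyclicShift, Equiv.coe_fn_mk,
      add_sub_cancel_right, residue, hκ c, eq_sub_iff_add_eq, add_assoc]
  exact_mod_cast h

theorem content_shift_pow {e r d η : ℕ} [NeZero r] {κ : ZMod r → ZMod e}
    (hκ : Compatible d η κ) (l : Multipartition r) (n : ℕ) :
    content κ ((shiftMultipartition r d ^ n) l) = (shiftQPlus e η ^ n) (content κ l) := by
  induction n with
  | zero => rfl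
  | succ n ih =>
    rw [pow_succ', pow_succ', Equiv.Perm.mul_apply, Equiv.Perm.mul_apply, content_shift hκ, ih]

theorem minimalPeriod_pos {X : Type} {σ : Equiv.Perm X} {n : ℕ} (hn : 0 < n) (hσ : σ ^ n = 1)
    (x : X) : 0 < Function.minimalPeriod σ x :=
  Function.IsPeriodicPt.minimalPeriod_pos hn (by
    rw [Function.IsPeriodicPt, Function.IsFixedPt, Equiv.Perm.iterate_eq_pow, hσ]; rfl)

/-- Finite order makes the minimal period positive, so the orbit is finite and `ncard` is its true
size. -/
theorem ncard_orbit {X : Type} {σ : Equiv.Perm X} {n : ℕ} (hn : 0 < n) (hσ : σ ^ n = 1) (x : X) :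
    (orbit σ x).ncard = Function.minimalPeriod σ x := by
  have : NeZero (Function.minimalPeriod (σ • ·) x) := ⟨(minimalPeriod_pos hn hσ x).ne'⟩
  have : Fintype (MulAction.orbit (Subgroup.zpowers σ) x) :=
    Fintype.ofEquiv _ (MulAction.orbitZPowersEquiv σ x).symm
  have h := MulAction.minimalPeriod_eq_card (a := σ) (b := x)
  rw [← Nat.card_eq_fintype_card] at h
  exact h.symm

theorem minimalPeriod_dvd_iff {X : Type} {σ : Equiv.Perm X} {x : X} {n : ℕ} :
    Function.minimalPeriod σ x ∣ n ↔ (σ ^ n) x = x := by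
  rw [← Function.isPeriodicPt_iff_minimalPeriod_dvd, Function.IsPeriodicPt, Function.IsFixedPt,
    Equiv.Perm.iterate_eq_pow]

/-! ### Descent modulo `η` and shift-invariant multipartitions -/

theorem apply_add_mul {e η : ℕ} {X : Type} (f : ZMod e → X) (hf : ∀ u, f (u + η) = f u)
    (u : ZMod e) (k : ℕ) : f (u + η * k) = f u := by
  induction k with
  | zero => simp
  | succ k ih =>
    push_cast
    rw [mul_add, mul_one, ← add_assoc, hf, ih]

theorem Compatible.apply_add_mul {e r d η : ℕ} {κ : ZMod r → ZMod e} (hκ : Compatible d η κ)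
    (c : ZMod r) (k : ℕ) : κ (c + d * k) = κ c + η * k := by
  induction k with
  | zero => simp
  | succ k ih =>
    push_cast
    rw [mul_add, mul_one, ← add_assoc, hκ, ih]
    ring

theorem sum_zmod_mul {d p r : ℕ} [NeZero r] [NeZero d] (hr : r = d * p) (g : ZMod r → ℤ) :
    ∑ c, g c = ∑ j : ZMod d, ∑ k ∈ Finset.range p, g ((j.val : ZMod r) + d * k) := by
  have h := sum_range_mul_eq d p fun m => g m
  rw [← hr, ← sum_zmod_eq_sum_range] at h
  rw [h]
  push_cast
  rfl

/-- For `k < p`, the elements `w + η * k` run once through the fibre of ℤ/e → ℤ/η containing `w`. -/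
theorem sum_fiber {η p e : ℕ} [NeZero η] [NeZero e] (he : e = η * p) (hd : η ∣ e) (v w : ZMod e) :
    (∑ k ∈ Finset.range p, if w + η * k = v then (1 : ℤ) else 0) =
      if ZMod.castHom hd (ZMod η) w = ZMod.castHom hd (ZMod η) v then 1 else 0 := by
  have hη := NeZero.pos η
  split_ifs with h
  · have h0 : (((v - w).val : ℕ) : ZMod η) = 0 := by
      rw [← map_natCast (ZMod.castHom hd (ZMod η)), ZMod.natCast_zmod_val, map_sub, h, sub_self]
    obtain ⟨k₀, hk₀⟩ := (ZMod.natCast_eq_zero_iff _ _).1 h0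
    have hlt : k₀ < p := by
      have := (v - w).val_lt
      rw [hk₀, he] at this
      exact lt_of_mul_lt_mul_left this hη.le
    have hv : w + η * k₀ = v := by
      have : (((v - w).val : ℕ) : ZMod e) = v - w := ZMod.natCast_zmod_val _
      rw [hk₀] at this
      push_cast at this
      rw [this]
      ring
    rw [Finset.sum_eq_single k₀, if_pos hv]
    · intro k hk hne
      refine if_neg fun hk' => hne ?_
      have h1 : ((η * k : ℕ) : ZMod e) = v - w := by push_cast; rw [← hk']; ring
      have h2 : η * k < e := by
        rw [he]; exact Nat.mul_lt_mul_of_pos_left (Finset.mem_range.1 hk) hη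
      have h3 := congrArg ZMod.val h1
      rw [ZMod.val_natCast_of_lt h2, hk₀] at h3
      exact Nat.eq_of_mul_eq_mul_left hη h3
    · intro hk
      exact absurd (Finset.mem_range.2 hlt) hk
  · refine Finset.sum_eq_zero fun k _ => if_neg fun hk => h ?_
    rw [← hk, map_add, map_mul, map_natCast, ZMod.natCast_self, zero_mul, add_zero]

theorem exists_shift_invariant {d η p e r : ℕ} [NeZero r] (hd : 0 < d) (hη : 0 < η) (hp : 0 < p)
    (he : e = η * p) (hr : r = d * p) {κ : ZMod r → ZMod e} (hκ : Compatible d η κ)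
    {α : QPlus e} (hα : (block κ α).Nonempty) (hinv : ∀ u, α (u + η) = α u) :
    ∃ μ : Multipartition r, content κ μ = α ∧ ∀ c, μ (c + d) = μ c := by
  have : NeZero d := ⟨hd.ne'⟩
  have : NeZero η := ⟨hη.ne'⟩
  have : NeZero e := ⟨by rw [he]; exact (Nat.mul_pos hη hp).ne'⟩
  have : Nonempty (Fin p) := ⟨⟨0, hp⟩⟩
  have hηe : η ∣ e := ⟨p, he⟩
  have hdr : d ∣ r := ⟨p, hr⟩
  obtain ⟨l, hl⟩ := hα
  have hl : content κ l = α := hl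
  let π := ZMod.castHom hηe (ZMod η)
  let s : ZMod d → ZMod η := fun c => π (κ (c.val : ZMod r))
  let a : ZMod η → ℤ := fun i => α (i.val : ZMod e)
  have ha : ∀ u, a (π u) = α u := by
    intro u
    have h1 : (π u).val = u.val % η := by
      have : π u = ((u.val : ℕ) : ZMod η) := by
        rw [← map_natCast π, ZMod.natCast_zmod_val]
      rw [this, ZMod.val_natCast]
    have h2 : ((u.val % η : ℕ) : ZMod e) + η * (u.val / η : ℕ) = u := by
      have := congrArg (fun n : ℕ => (n : ZMod e)) (Nat.mod_add_div u.val η)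
      simpa only [Nat.cast_add, Nat.cast_mul, ZMod.natCast_zmod_val] using this
    have h3 := apply_add_mul α hinv ((u.val % η : ℕ) : ZMod e) (u.val / η)
    simp only [a]
    rw [h1, ← h3, h2]
  have hs : ∀ (x y : ℕ) (c : ZMod d) (k : ℕ), π (residue κ x y ((c.val : ZMod r) + d * k))
      = (y : ZMod η) - x + s c := by
    intro x y c k
    simp [residue, hκ.apply_add_mul, s]
  obtain ⟨γ, hγ, hγa⟩ := exists_family_of_average (K := Fin p) s
    (fun k c => diagramContent (s c) (l ((c.val : ZMod r) + d * (k : ℕ))).diagram)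
    (fun k c => sum_sq_le_diagramContent (s c) _) a (by
      intro i
      -- Counting nodes by residue modulo `η` means summing `α` over a fibre, where it is constant
      -- with `p` terms.
      have h1 : ∑ k ∈ Finset.range p, (content κ l ((i.val : ZMod e) + η * k) : ℤ) = p * a i := by
        rw [hl]
        simp [apply_add_mul α hinv, a]
      rw [Fintype.card_fin, ← h1]
      simp only [content_apply]
      rw [Finset.sum_comm]
      have h2 : ∀ c, (∑ k ∈ Finset.range p, ∑ ν ∈ (l c).diagram.cells,
          if residue κ ν.1 ν.2 c = (i.val : ZMod e) + η * k then (1 : ℤ) else 0) =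
          ∑ ν ∈ (l c).diagram.cells, if π (residue κ ν.1 ν.2 c) = i then (1 : ℤ) else 0 := by
        intro c
        rw [Finset.sum_comm]
        refine Finset.sum_congr rfl fun ν _ => ?_
        have h3 := sum_fiber he hηe (residue κ ν.1 ν.2 c) (i.val : ZMod e)
        rw [map_natCast, ZMod.natCast_zmod_val] at h3
        simp only [eq_comm] at h3 ⊢
        exact h3
      rw [Finset.sum_comm (s := Finset.range p)]
      simp only [h2]
      rw [sum_zmod_mul hr]
      refine Finset.sum_congr rfl fun c _ => ?_
      simp only [hs]
      rw [← Fin.sum_univ_eq_sum_range (fun k =>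
        ∑ ν ∈ (l ((c.val : ZMod r) + d * (k : ZMod r))).diagram.cells,
          if (ν.2 : ZMod η) - ν.1 + s c = i then (1 : ℤ) else 0)]
      rfl)
  choose ν hν using fun c => exists_diagramContent_eq (s c) (γ c) (hγ c)
  choose w hw using fun c => IntPartition.exists_diagram_eq (ν c)
  -- The `d` diagrams are repeated `p` times; the copies of a node take each residue above its class
  -- modulo `η` exactly once.
  refine ⟨fun c => w (ZMod.castHom hdr (ZMod d) c), ?_, fun c => by
    beta_reduce
    rw [map_add, map_natCast, ZMod.natCast_self, add_zero]⟩
  funext u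
  have : (content κ (fun c => w (ZMod.castHom hdr (ZMod d) c)) u : ℤ) = α u := by
    rw [← ha, ← hγa, content_apply, sum_zmod_mul hr]
    refine Finset.sum_congr rfl fun c _ => ?_
    have h1 : ∀ k : ℕ, ZMod.castHom hdr (ZMod d) ((c.val : ZMod r) + d * k) = c := by
      intro k
      rw [map_add, map_mul, map_natCast, map_natCast, ZMod.natCast_self, zero_mul, add_zero,
        ZMod.natCast_zmod_val]
    simp only [h1, hw]
    rw [Finset.sum_comm, ← hν, diagramContent]
    refine Finset.sum_congr rfl fun q _ => ?_
    have h2 := sum_fiber he hηe u (residue κ q.1 q.2 ((c.val : ZMod r)))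
    have h3 := hs q.1 q.2 c 0
    simp only [Nat.cast_zero, mul_zero, add_zero] at h3
    change _ = if π _ = π u then (1 : ℤ) else 0 at h2
    rw [h3] at h2
    rw [← h2]
    refine Finset.sum_congr rfl fun k _ => ?_
    simp only [residue, hκ.apply_add_mul, add_assoc]
  exact_mod_cast this

/-- By Bézout, `gcd(j, p)` is an integral combination of `j` and `p`, and `η * p` vanishes in ℤ/e.
-/
theorem apply_add_gcd {η p e : ℕ} (he : e = η * p) {X : Type} {f : ZMod e → X} {j : ℕ}
    (hf : ∀ u, f (u - j * η) = f u) (u : ZMod e) :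
    f (u + ((η * Nat.gcd j p : ℕ) : ZMod e)) = f u := by
  have hper : Function.Periodic f ((j : ZMod e) * η) := fun v => by
    rw [← hf, add_sub_cancel_right]
  have h := hper.int_mul (Nat.gcdA j p) u
  rw [← h]
  congr 2
  have h1 := congrArg (fun z : ℤ => (z : ZMod e)) (Nat.gcd_eq_gcd_ab j p)
  have h2 : (η : ZMod e) * p = 0 := by
    rw [← Nat.cast_mul, ← he, ZMod.natCast_self]
  push_cast at h1 ⊢
  rw [h1]
  linear_combination (Nat.gcdB j p : ZMod e) * h2

theorem exists_fixed {d η p e r : ℕ} [NeZero r] (hd : 0 < d) (hη : 0 < η) (hp : 0 < p)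
    (he : e = η * p) (hr : r = d * p) {κ : ZMod r → ZMod e} (hκ : Compatible d η κ)
    {α : QPlus e} (hα : (block κ α).Nonempty) (j : ℕ) (hj : (shiftQPlus e η ^ j) α = α) :
    ∃ μ : Multipartition r, content κ μ = α ∧ (shiftMultipartition r d ^ j) μ = μ := by
  have hinv : ∀ u, α (u - j * η) = α u := fun u => by
    have := congrFun hj u
    rwa [shiftQPlus, cyclicShift_pow_apply] at this
  obtain ⟨p', hp'⟩ := Nat.gcd_dvd_right j p
  obtain ⟨m, hm⟩ := Nat.gcd_dvd_left j p
  have hg : 0 < Nat.gcd j p := Nat.gcd_pos_of_pos_right _ hp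
  have hκ' : Compatible (d * Nat.gcd j p) (η * Nat.gcd j p) κ := fun c => by
    push_cast
    exact hκ.apply_add_mul c _
  obtain ⟨μ, hμ, hμs⟩ := exists_shift_invariant (d := d * Nat.gcd j p) (η := η * Nat.gcd j p)
    (p := p') (Nat.mul_pos hd hg) (Nat.mul_pos hη hg)
    (Nat.pos_of_ne_zero fun h => by simp [h] at hp'; omega)
    (by rw [he, mul_assoc, ← hp']) (by rw [hr, mul_assoc, ← hp']) hκ' hα (apply_add_gcd he hinv)
  refine ⟨μ, hμ, ?_⟩
  funext c
  rw [shiftMultipartition, cyclicShift_pow_apply]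
  -- Since `j = gcd(j, p) * m`, the shift by `j * d` is undone by `m` steps of the known period.
  rw [← apply_add_mul μ hμs (c - j * d) m]
  congr 1
  have : (j : ZMod r) = (Nat.gcd j p : ZMod r) * m := by exact_mod_cast congrArg Nat.cast hm
  push_cast
  linear_combination -(d : ZMod r) * this

end Shift

theorem mainTheorem2 (d η p e r : ℕ) [NeZero r] (hd : 0 < d) (hη : 0 < η) (hp : 0 < p)
    (he : e = η * p) (hr : r = d * p) (he2 : 2 ≤ e)
    (κ : ZMod r → ZMod e) (hκ : Shift.Compatible d η κ)
    (α : Shift.QPlus e) (hα : (Shift.block κ α).Nonempty) :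
    IsLeast ((fun l => (Shift.orbit (Shift.shiftMultipartition r d) l).ncard) '' Shift.block κ α)
        (Shift.orbit (Shift.shiftQPlus e η) α).ncard ∧
      ∀ j : ℕ, (Shift.shiftQPlus e η ^ j) α = α →
        ∃ μ : Shift.Multipartition r,
          Shift.content κ μ = α ∧ (Shift.shiftMultipartition r d ^ j) μ = μ := by
  have hfix := Shift.exists_fixed hd hη hp he hr hκ hα
  have hQ : Shift.shiftQPlus e η ^ e = 1 := Shift.cyclicShift_pow_self e η
  have hM : Shift.shiftMultipartition r d ^ r = 1 := Shift.cyclicShift_pow_self r d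
  have he0 : 0 < e := by omega
  have hr0 : 0 < r := NeZero.pos r
  have hle : ∀ l, Shift.content κ l = α → Function.minimalPeriod (Shift.shiftQPlus e η) α ≤
      Function.minimalPeriod (Shift.shiftMultipartition r d) l := by
    rintro l rfl
    refine Nat.le_of_dvd (Shift.minimalPeriod_pos hr0 hM l) (Shift.minimalPeriod_dvd_iff.2 ?_)
    rw [← Shift.content_shift_pow hκ, Shift.minimalPeriod_dvd_iff.1 dvd_rfl]
  refine ⟨⟨?_, ?_⟩, hfix⟩
  · obtain ⟨μ, hμ, hμj⟩ := hfix _ (Shift.minimalPeriod_dvd_iff.1 dvd_rfl)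
    refine ⟨μ, hμ, ?_⟩
    simp only [Shift.ncard_orbit hr0 hM, Shift.ncard_orbit he0 hQ]
    exact le_antisymm (Nat.le_of_dvd (Shift.minimalPeriod_pos he0 hQ α)
      (Shift.minimalPeriod_dvd_iff.2 hμj)) (hle μ hμ)
  · rintro _ ⟨l, hl, rfl⟩
    simp only [Shift.ncard_orbit hr0 hM, Shift.ncard_orbit he0 hQ]
    exact hle l hl
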